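/- Let $d\ge 0$ be an integer and let $I^d=[0,1)^d$ be the unit cube in $\mathbb R^d$; write $m$ for Lebesgue measure on $\mathbb R^d$ and $e_\lambda(x)=e^{2\pi i\,\lambda\cdot x}$, where $\lambda\cdot x=\sum_j\lambda_jx_j$. For a measurable set $\Omega\subset\mathbb R^d$ and a set $\Lambda\subset\mathbb R^d$: - $(\Omega,\Lambda)$ is a *spectral pair* if $0<m(\Omega)<\infty$ and the exponentials $e_\lambda$, $\lambda\in\Lambda$, form an orthogonal basis of $L^2(\Omega)$, that is, they are pairwise orthogonal and their linear span is dense. - $\Omega$ is a *$\Lambda$-tile* if $m(\Omega)>0$, the translates $\Omega+\lambda$, $\lambda\in\Lambda$, cover $\mathbb R^d$ up to a set of measure zero, and $m\big((\Omega+\lambda)\cap(\Omega+\lambda')\big)=0$ for all $\lambda\neq\lambda'$ in $\Lambda$. Let $\mathbf Z_{I^d}\subset\mathbb C^d$ be the zero set of the function $z\mapsto\int_{I^d}e^{2\pi i\,z\cdot x}\,dx$; equivalently, $\mathbf Z_{I^d}$ is the set of those $z\in\mathbb C^d$ at least one of whose coordinates is a nonzero integer. **Theorem.** Let $R$ be an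 invertible $d\times d$ matrix with real entries, let $L=R\mathbb Z^d$ be the lattice generated by the columns of $R$, and let $\mathbf L\subset\mathbb R^d$ be a finite set with $|\mathbf L|$ elements. If $L\cap(\mathbf L-\mathbf L)=\{0\}$, then the following are equivalent: 1. $(I^d,L+\mathbf L)$ is a spectral pair. 2. $I^d$ is an $(L+\mathbf L)$-tile. 3. $|\mathbf L|=|\det R|$ and $L+(\mathbf L-\mathbf L)\subset\mathbf Z_{I^d}\cup\{0\}$. Consequently, if $\Lambda\subset\mathbb R^d$ is any periodic set, that is, $\Lambda=R\mathbb Z^d+F$ for some invertible real $d\times d$ matrix $R$ and some finite set $F\subset\mathbb R^d$, then $(I^d,\Lambda)$ is a spectral pair if and only if $I^d$ is a $\Lambda$-tile. -/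

import Mathlib

open MeasureTheory
open scoped Pointwise

namespace CubeSpectra

noncomputable section

/-- The unit cube `I^d = [0,1)^d`, as a subset of `ℝ^d`. The space `ℝ^d` is `Fin d → ℝ` with
Lebesgue measure `volume`; no norm on it plays any role below. -/
def unitCube (d : ℕ) : Set (Fin d → ℝ) := Set.univ.pi fun _ => Set.Ico (0 : ℝ) 1

/-- The exponential `e_l(x) = exp(i 2π l·x)` on `ℝ^d`, where `l·x = ∑ j, l_j x_j`. -/
def expFun {d : ℕ} (l x : Fin d → ℝ) : ℂ :=
  Complex.exp (2 * (Real.pi : ℂ) * Complex.I * ((∑ j, l j * x j : ℝ) : ℂ))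

/-- `(Ω, Λ)` is a spectral pair: `Ω` is a measurable set of finite positive Lebesgue measure and the
exponentials `e_l`, `l ∈ Λ`, form an orthogonal basis of the Hilbert space `L²(Ω)`, that is, they
are pairwise orthogonal and their linear span is dense. -/
structure IsSpectralPair {d : ℕ} (Ω Λ : Set (Fin d → ℝ)) : Prop where
  measurable : MeasurableSet Ω
  pos : 0 < volume Ω
  finite : volume Ω < ⊤
  orthogonal : ∀ l ∈ Λ, ∀ l' ∈ Λ, l ≠ l' →
    ∫ x in Ω, (starRingEnd ℂ) (expFun l x) * expFun l' x = 0
  total : (Submodule.span ℂ {g : Lp ℂ 2 (volume.restrict Ω) |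
    ∃ l ∈ Λ, g =ᵐ[volume.restrict Ω] expFun l}).topologicalClosure = ⊤

/-- `(Ω, Λ)` is a tiling pair (`Ω` is a `Λ`-tile): `Ω` is a measurable set of nonzero Lebesgue
measure, its translates `Ω + l`, `l ∈ Λ`, cover `ℝ^d` up to a null set, and two translates by
distinct vectors of `Λ` meet in a null set. -/
structure IsTilingPair {d : ℕ} (Ω Λ : Set (Fin d → ℝ)) : Prop where
  measurable : MeasurableSet Ω
  pos : 0 < volume Ω
  cover : volume (⋃ l ∈ Λ, (fun x => x + l) '' Ω)ᶜ = 0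
  disjoint : ∀ l ∈ Λ, ∀ l' ∈ Λ, l ≠ l' →
    volume (((fun x => x + l) '' Ω) ∩ ((fun x => x + l') '' Ω)) = 0

/-- The zero set `Z_{I^d} ⊆ ℂ^d` of the entire function `z ↦ ∫_{I^d} exp(i 2π z·x) dx`. -/
def cubeZeroSet (d : ℕ) : Set (Fin d → ℂ) :=
  {z | ∫ x in unitCube d,
    Complex.exp (2 * (Real.pi : ℂ) * Complex.I * ∑ j, z j * ((x j : ℝ) : ℂ)) = 0}

/-- The inclusion `ℝ^d ⊆ ℂ^d`. -/
def toComplexVec {d : ℕ} (v : Fin d → ℝ) : Fin d → ℂ := fun j => ((v j : ℝ) : ℂ)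

/-- The lattice `R ℤ^d` generated by the columns of `R`. -/
def matrixLattice {d : ℕ} (R : Matrix (Fin d) (Fin d) ℝ) : Set (Fin d → ℝ) :=
  Set.range fun k : Fin d → ℤ => R.mulVec fun j => (k j : ℝ)

/-- A set is periodic if it is of the form `R ℤ^d + F` with `R` an invertible real matrix and `F`
a finite set. -/
def IsPeriodicSet {d : ℕ} (T : Set (Fin d → ℝ)) : Prop :=
  ∃ (R : Matrix (Fin d) (Fin d) ℝ) (F : Finset (Fin d → ℝ)),
    R.det ≠ 0 ∧ T = matrixLattice R + (F : Set (Fin d → ℝ))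

end

end CubeSpectra

/-! Write Λ = L + F with F incongruent modulo L. Both properties of Λ turn out to be equivalent to
one condition: |F| = |det R|, and any two points of Λ differ by a nonzero integer in some coordinate
(`IsSeparated`).

The count comes from averaging. If h ≥ 0 has integral 1, then ∑ h(t - l) over l ∈ Λ is L-periodic
with integral |F| over a cell of volume |det R|. So if the sum is 1 a.e., then |F| = |det R|;
conversely, if it is at most 1 everywhere and |F| = |det R|, it is 1 a.e.

For tiling, h is the indicator of the cube: separated cubes are disjoint, which gives the bound, and
a tiling is separated by Keller's theorem (`IsCubePartition.isSeparated`). For spectra, h is the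
power spectrum of the cube: separation is orthogonality of the exponentials, the bound is Bessel's
inequality for e_t, and equality for a.e. t puts e_t in the closed span, hence every e_t by
continuity. The integer frequencies alone are total, so the span is dense. -/

namespace CubeSpectra

/-! ### Keller's theorem on cube partitions -/

/-- Two vectors are separated when some coordinate of their difference is a nonzero integer. -/
def IsSeparated {d : ℕ} (x y : Fin d → ℝ) : Prop :=
  ∃ j, ∃ n : ℤ, n ≠ 0 ∧ x j - y j = n

/-- The cubes `c τ + [0,1)^d` partition `ℝ^d`. -/
def IsCubePartition {d : ℕ} {ι : Type*} (c : ι → Fin d → ℝ) : Prop :=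
  ∀ x : Fin d → ℝ, ∃! τ, ∀ j, c τ j ≤ x j ∧ x j < c τ j + 1

/-- The interval containing `a τ + 1` must start there, since otherwise its left endpoint would also
lie in the interval of `τ`. Similarly on the left, so intervals start at all points of `a τ + ℤ`;
these already fill the line and leave no room for others. -/
theorem exists_int_sub_of_partition_line {S : Type*} {a : S → ℝ}
    (h : ∀ u : ℝ, ∃! τ, a τ ≤ u ∧ u < a τ + 1) (τ σ : S) : ∃ n : ℤ, a σ = a τ + n := by
  have up : ∀ τ, ∃ σ, a σ = a τ + 1 := by
    intro τ
    obtain ⟨σ, ⟨h1, h2⟩, -⟩ := h (a τ + 1)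
    refine ⟨σ, ?_⟩
    by_contra hne
    have hlt : a σ < a τ + 1 := lt_of_le_of_ne h1 hne
    have := (h (a σ)).unique (y₁ := τ) (y₂ := σ) ⟨by linarith, hlt⟩ ⟨le_rfl, by linarith⟩
    rw [this] at h2
    linarith
  have down : ∀ τ, ∃ σ, a σ = a τ - 1 := by
    intro τ
    obtain ⟨σ, ⟨h1, h2⟩, -⟩ := h (a τ - 1)
    obtain ⟨ρ, hρ⟩ := up σ
    have := (h (a τ)).unique (y₁ := τ) (y₂ := ρ) ⟨le_rfl, by linarith⟩
      ⟨by linarith, by linarith⟩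
    exact ⟨σ, by rw [this]; linarith⟩
  have all : ∀ n : ℤ, ∃ σ, a σ = a τ + n := by
    intro n
    induction n using Int.induction_on with
    | zero => exact ⟨τ, by simp⟩
    | succ k ih =>
      obtain ⟨σ, hσ⟩ := ih
      obtain ⟨ρ, hρ⟩ := up σ
      exact ⟨ρ, by rw [hρ, hσ]; push_cast; ring⟩
    | pred k ih =>
      obtain ⟨σ, hσ⟩ := ih
      obtain ⟨ρ, hρ⟩ := down σ
      exact ⟨ρ, by rw [hρ, hσ]; push_cast; ring⟩
  obtain ⟨ρ, hρ⟩ := all ⌊a σ - a τ⌋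
  have h1 := Int.floor_le (a σ - a τ)
  have h2 := Int.lt_floor_add_one (a σ - a τ)
  have := (h (a σ)).unique (y₁ := σ) (y₂ := ρ) ⟨le_rfl, by linarith⟩
    ⟨by linarith, by linarith⟩
  exact ⟨_, by rw [this]; exact hρ⟩

theorem mem_cube_update_iff {d : ℕ} (t x : Fin d → ℝ) (i : Fin d) (u : ℝ) :
    (∀ j, t j ≤ Function.update x i u j ∧ Function.update x i u j < t j + 1) ↔
      (∀ j, j ≠ i → t j ≤ x j ∧ x j < t j + 1) ∧ t i ≤ u ∧ u < t i + 1 := by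
  constructor
  · intro h
    refine ⟨fun j hj => ?_, ?_⟩
    · simpa [Function.update_of_ne hj] using h j
    · simpa using h i
  · rintro ⟨h1, h2⟩ j
    by_cases hj : j = i
    · subst hj; simpa using h2
    · simpa [Function.update_of_ne hj] using h1 j hj

/-- Two cubes of a partition that meet a common line parallel to the `i`-th axis have `i`-th
coordinates that agree modulo `1`. -/
theorem IsCubePartition.exists_int_of_line {d : ℕ} {ι : Type*} {c : ι → Fin d → ℝ}
    (hc : IsCubePartition c) (x : Fin d → ℝ) (i : Fin d) {τ σ : ι} {u v : ℝ}
    (hτ : ∀ j, c τ j ≤ Function.update x i u j ∧ Function.update x i u j < c τ j + 1)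
    (hσ : ∀ j, c σ j ≤ Function.update x i v j ∧ Function.update x i v j < c σ j + 1) :
    ∃ n : ℤ, c σ i = c τ i + n := by
  have key := exists_int_sub_of_partition_line
    (S := {τ : ι // ∀ j, j ≠ i → c τ j ≤ x j ∧ x j < c τ j + 1}) (a := fun τ => c τ.1 i)
  rw [mem_cube_update_iff] at hτ hσ
  refine key (fun w => ?_) ⟨τ, hτ.1⟩ ⟨σ, hσ.1⟩
  obtain ⟨ρ, hρ, huniq⟩ := hc (Function.update x i w)
  rw [mem_cube_update_iff] at hρ
  refine ⟨⟨ρ, hρ.1⟩, hρ.2, fun y hy => Subtype.ext (huniq y.1 ?_)⟩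
  exact (mem_cube_update_iff _ _ _ _).2 ⟨y.2, hy⟩

open Classical in
/-- Slide by `s` in direction `i` all cubes whose `i`-th coordinate agrees with `α` modulo `1`. -/
noncomputable def slide {d : ℕ} {ι : Type*} (c : ι → Fin d → ℝ) (i : Fin d) (α s : ℝ) :
    ι → Fin d → ℝ := fun τ =>
  if ∃ n : ℤ, c τ i = α + n then Function.update (c τ) i (c τ i + s) else c τ

/-- The cubes meeting a given line in direction `i` all lie in one class modulo 1. Hence each such
line is either shifted rigidly or left alone, and stays partitioned. -/
theorem IsCubePartition.slide {d : ℕ} {ι : Type*} {c : ι → Fin d → ℝ} (hc : IsCubePartition c)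
    (i : Fin d) (α s : ℝ) : IsCubePartition (slide c i α s) := by
  intro x
  have moved : ∀ τ, (∃ n : ℤ, c τ i = α + n) →
      ((∀ j, CubeSpectra.slide c i α s τ j ≤ x j ∧ x j < CubeSpectra.slide c i α s τ j + 1) ↔
        ∀ j, c τ j ≤ Function.update x i (x i - s) j ∧
          Function.update x i (x i - s) j < c τ j + 1) := by
    intro τ hτ
    have e : CubeSpectra.slide c i α s τ = Function.update (c τ) i (c τ i + s) := if_pos hτ
    rw [e]
    refine forall_congr' fun j => ?_
    by_cases hj : j = i
    · subst hj
      simp only [Function.update_self]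
      constructor <;> rintro ⟨h1, h2⟩ <;> constructor <;> linarith
    · simp only [Function.update_of_ne hj]
  have fixed : ∀ τ, ¬ (∃ n : ℤ, c τ i = α + n) → CubeSpectra.slide c i α s τ = c τ :=
    fun τ hτ => if_neg hτ
  obtain ⟨τ, hτ, hτu⟩ := hc x
  obtain ⟨σ, hσ, hσu⟩ := hc (Function.update x i (x i - s))
  have hx : ∀ j, c τ j ≤ Function.update x i (x i) j ∧ Function.update x i (x i) j < c τ j + 1 := by
    rwa [Function.update_eq_self]
  obtain ⟨m, hm⟩ := hc.exists_int_of_line x i hx hσ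
  by_cases hα : ∃ n : ℤ, c τ i = α + n
  · have hα' : ∃ n : ℤ, c σ i = α + n := by
      obtain ⟨n, hn⟩ := hα
      exact ⟨n + m, by rw [hm, hn]; push_cast; ring⟩
    refine ⟨σ, (moved σ hα').2 hσ, fun ρ hρ => ?_⟩
    by_cases hρα : ∃ n : ℤ, c ρ i = α + n
    · exact hσu ρ ((moved ρ hρα).1 hρ)
    · have : ρ = τ := hτu ρ (by simpa only [fixed ρ hρα] using hρ)
      exact absurd (this ▸ hα) hρα
  · refine ⟨τ, by simpa only [fixed τ hα] using hτ, fun ρ hρ => ?_⟩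
    by_cases hρα : ∃ n : ℤ, c ρ i = α + n
    · have : ρ = σ := hσu ρ ((moved ρ hρα).1 hρ)
      subst this
      obtain ⟨n, hn⟩ := hρα
      exact absurd ⟨n - m, by push_cast; linarith⟩ hα
    · exact hτu ρ (by simpa only [fixed ρ hρα] using hρ)

/-- **Keller's theorem**: two distinct cubes of a partition of `ℝ^d` into unit cubes are separated
by a nonzero integer in some coordinate. -/
theorem IsCubePartition.isSeparated {d : ℕ} {ι : Type*} {c : ι → Fin d → ℝ}
    (hc : IsCubePartition c) {τ σ : ι} (hne : τ ≠ σ) : IsSeparated (c τ) (c σ) := by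
  classical
  by_contra hsep
  -- Sliding the class of `τ` until its `i`-th coordinate equals that of `σ` yields another
  -- partition in which the two corners still are not separated but differ in one coordinate fewer.
  -- Once they agree everywhere, two distinct cubes coincide.
  induction hk : (Finset.univ.filter fun j => c τ j ≠ c σ j).card generalizing c with
  | zero =>
    have heq : c τ = c σ := by
      funext j
      by_contra hj
      have : j ∈ Finset.univ.filter fun j => c τ j ≠ c σ j := by simpa using hj
      rw [Finset.card_eq_zero] at hk
      rw [hk] at this
      simp at this
    refine hne ((hc (c τ)).unique (y₁ := τ) (y₂ := σ) (fun j => ⟨le_rfl, by linarith⟩) ?_)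
    rw [heq]
    exact fun j => ⟨le_rfl, by linarith⟩
  | succ k ih =>
    obtain ⟨i, hi⟩ : (Finset.univ.filter fun j => c τ j ≠ c σ j).Nonempty := by
      rw [← Finset.card_pos]; omega
    have hi' : c τ i ≠ c σ i := by simpa using hi
    -- A nonzero integer difference would separate the corners, so `σ` is outside the sliding class
    -- and stays put.
    have hσ : ¬ ∃ n : ℤ, c σ i = c τ i + n := by
      rintro ⟨n, hn⟩
      refine hsep ⟨i, -n, ?_, by push_cast; linarith⟩
      rintro h0
      have : n = 0 := by omega
      subst this
      exact hi' (by simpa using hn.symm)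
    have e1 : CubeSpectra.slide c i (c τ i) (c σ i - c τ i) τ
        = Function.update (c τ) i (c σ i) := by
      unfold CubeSpectra.slide
      rw [if_pos ⟨0, by simp⟩]
      congr 1
      ring
    have e2 : CubeSpectra.slide c i (c τ i) (c σ i - c τ i) σ = c σ := if_neg hσ
    refine ih (hc.slide i (c τ i) (c σ i - c τ i)) ?_ ?_
    · rw [e1, e2]
      rintro ⟨j, n, hn, hj⟩
      by_cases hji : j = i
      · subst hji
        simp only [Function.update_self, sub_self] at hj
        exact hn (by exact_mod_cast hj.symm)
      · rw [Function.update_of_ne hji] at hj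
        exact hsep ⟨j, n, hn, hj⟩
    · rw [e1, e2]
      have : (Finset.univ.filter fun j => Function.update (c τ) i (c σ i) j ≠ c σ j)
          = (Finset.univ.filter fun j => c τ j ≠ c σ j).erase i := by
        ext j
        by_cases hji : j = i
        · subst hji; simp
        · simp [hji]
      rw [this, Finset.card_erase_of_mem hi, hk]
      rfl

/-! ### Lattices and averages of periodized functions -/

/-- The basis of `ℝ^d` formed by the columns of an invertible matrix. -/
noncomputable def columnBasis {d : ℕ} (R : Matrix (Fin d) (Fin d) ℝ) (hR : R.det ≠ 0) :
    Module.Basis (Fin d) ℝ (Fin d → ℝ) :=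
  (Pi.basisFun ℝ (Fin d)).map
    (LinearEquiv.ofIsUnitDet (f := Matrix.toLin' R) (v := Pi.basisFun ℝ (Fin d))
      (v' := Pi.basisFun ℝ (Fin d)) (by
        rw [← Matrix.toLin_eq_toLin', LinearMap.toMatrix_toLin]; exact hR.isUnit))

theorem columnBasis_apply {d : ℕ} (R : Matrix (Fin d) (Fin d) ℝ) (hR : R.det ≠ 0) (j : Fin d) :
    columnBasis R hR j = R.transpose j := by
  simp only [columnBasis, Module.Basis.map_apply, Pi.basisFun_apply,
    LinearEquiv.ofIsUnitDet_apply, Matrix.toLin'_apply, Matrix.mulVec_single_one]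
  rfl

/-- The lattice `R ℤ^d` as a `ℤ`-submodule. -/
noncomputable abbrev latticeModule {d : ℕ} (R : Matrix (Fin d) (Fin d) ℝ) (hR : R.det ≠ 0) :
    Submodule ℤ (Fin d → ℝ) := Submodule.span ℤ (Set.range (columnBasis R hR))

theorem coe_latticeModule {d : ℕ} (R : Matrix (Fin d) (Fin d) ℝ) (hR : R.det ≠ 0) :
    (latticeModule R hR : Set (Fin d → ℝ)) = matrixLattice R := by
  ext v
  rw [SetLike.mem_coe, Submodule.mem_span_range_iff_exists_fun]
  refine exists_congr fun k => ?_
  have : ∑ i, k i • columnBasis R hR i = R.mulVec fun j => (k j : ℝ) := by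
    ext i
    simp [columnBasis_apply, Matrix.mulVec, dotProduct, Finset.sum_apply, mul_comm]
  rw [this]

theorem mem_latticeModule {d : ℕ} {R : Matrix (Fin d) (Fin d) ℝ} (hR : R.det ≠ 0)
    {v : Fin d → ℝ} : v ∈ latticeModule R hR ↔ v ∈ matrixLattice R := by
  rw [← coe_latticeModule R hR]; rfl

instance {d : ℕ} (R : Matrix (Fin d) (Fin d) ℝ) (hR : R.det ≠ 0) :
    VAddInvariantMeasure (latticeModule R hR) (Fin d → ℝ) volume :=
  inferInstanceAs (VAddInvariantMeasure (latticeModule R hR).toAddSubgroup (Fin d → ℝ) volume)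

theorem volume_fundamentalDomain_columnBasis {d : ℕ} (R : Matrix (Fin d) (Fin d) ℝ)
    (hR : R.det ≠ 0) :
    volume (ZSpan.fundamentalDomain (columnBasis R hR)) = ENNReal.ofReal |R.det| := by
  rw [ZSpan.volume_fundamentalDomain, ← Matrix.det_transpose R]
  congr 3
  ext i j
  simp [columnBasis_apply]

/-- The elements of `F` are pairwise incongruent modulo the lattice `R ℤ^d`. -/
def IsIncongruent {d : ℕ} (R : Matrix (Fin d) (Fin d) ℝ) (F : Finset (Fin d → ℝ)) : Prop :=
  ∀ f ∈ F, ∀ f' ∈ F, f - f' ∈ matrixLattice R → f = f'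

section Periodic

variable {d : ℕ} {R : Matrix (Fin d) (Fin d) ℝ} (hR : R.det ≠ 0) {F : Finset (Fin d → ℝ)}

/-- If the elements of `F` are incongruent modulo `R ℤ^d`, then `R ℤ^d + F` is parametrized by
`R ℤ^d × F`. -/
noncomputable def periodicEquiv (hF : IsIncongruent R F) :
    latticeModule R hR × F ≃ (matrixLattice R + (F : Set (Fin d → ℝ)) : Set (Fin d → ℝ)) :=
  Equiv.ofBijective
    (fun p => ⟨p.1.1 + p.2.1, Set.add_mem_add ((mem_latticeModule hR).1 p.1.2) p.2.2⟩) (by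
      constructor
      · rintro ⟨g, f⟩ ⟨g', f'⟩ h
        simp only [Subtype.mk.injEq] at h
        have hf : f = f' := by
          refine Subtype.ext (hF _ f.2 _ f'.2 ((mem_latticeModule hR).1 ?_))
          have : f.1 - f'.1 = g'.1 - g.1 := by
            rw [sub_eq_sub_iff_add_eq_add, add_comm, h]
          rw [this]
          exact sub_mem g'.2 g.2
        subst hf
        exact Prod.ext (Subtype.ext (add_right_cancel h)) rfl
      · rintro ⟨_, g, hg, f, hf, rfl⟩
        exact ⟨(⟨g, (mem_latticeModule hR).2 hg⟩, ⟨f, hf⟩), rfl⟩)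

theorem coe_periodicEquiv (hF : IsIncongruent R F) (p : latticeModule R hR × F) :
    (periodicEquiv hR hF p : Fin d → ℝ) = p.1.1 + p.2.1 := rfl

theorem countable_periodic (hR : R.det ≠ 0) (hF : IsIncongruent R F) :
    Countable (matrixLattice R + (F : Set (Fin d → ℝ)) : Set (Fin d → ℝ)) :=
  (periodicEquiv hR hF).symm.injective.countable

/-- For each fixed `f`, the lattice translates of the fundamental domain tile the space, so the sum
over the lattice unfolds to the full integral of a translate of `h`. Each element of `F` contributes
one such integral. -/
theorem setLIntegral_tsum_periodic (hF : IsIncongruent R F) {h : (Fin d → ℝ) → ENNReal}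
    (hm : Measurable h) :
    ∫⁻ t in ZSpan.fundamentalDomain (columnBasis R hR),
        ∑' l : (matrixLattice R + (F : Set (Fin d → ℝ)) : Set (Fin d → ℝ)), h (t - l)
      = F.card * ∫⁻ t, h t := by
  have hm' : ∀ v : Fin d → ℝ, Measurable fun t => h (t - v) := fun v => by fun_prop
  have := countable_periodic hR hF
  rw [lintegral_tsum fun l => (hm' _).aemeasurable, ← (periodicEquiv hR hF).tsum_eq,
    ENNReal.tsum_prod', ENNReal.tsum_comm, tsum_fintype]
  have : ∀ f : F, ∑' g : latticeModule R hR,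
      ∫⁻ t in ZSpan.fundamentalDomain (columnBasis R hR), h (t - (periodicEquiv hR hF (g, f)).1)
        = ∫⁻ t, h t := by
    intro f
    rw [← lintegral_sub_right_eq_self h f.1,
      (ZSpan.isAddFundamentalDomain (columnBasis R hR) volume).lintegral_eq_tsum']
    refine tsum_congr fun g => ?_
    refine lintegral_congr fun t => ?_
    rw [coe_periodicEquiv, Submodule.vadd_def, vadd_eq_add]
    congr 1
    push_cast
    abel
  simp [this]

/-- Translation by a lattice vector only reindexes the sum. This carries almost everywhere
statements from a fundamental domain to the whole space. -/
theorem tsum_periodic_vadd (hF : IsIncongruent R F) (h : (Fin d → ℝ) → ENNReal)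
    (g : latticeModule R hR) (t : Fin d → ℝ) :
    ∑' l : (matrixLattice R + (F : Set (Fin d → ℝ)) : Set (Fin d → ℝ)), h ((g +ᵥ t) - l)
      = ∑' l : (matrixLattice R + (F : Set (Fin d → ℝ)) : Set (Fin d → ℝ)), h (t - l) := by
  rw [← (periodicEquiv hR hF).tsum_eq, ← (periodicEquiv hR hF).tsum_eq,
    ← ((Equiv.addRight g).prodCongr (Equiv.refl F)).tsum_eq]
  refine tsum_congr fun p => ?_
  simp only [coe_periodicEquiv, Submodule.vadd_def, vadd_eq_add]
  congr 1
  simp only [Equiv.prodCongr_apply, Prod.map, Equiv.coe_addRight, Equiv.refl_apply,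
    Submodule.coe_add]
  abel

theorem card_eq_abs_det_of_tsum_eq_one (hR : R.det ≠ 0) (hF : IsIncongruent R F)
    {h : (Fin d → ℝ) → ENNReal} (hm : Measurable h) (hh : ∫⁻ t, h t = 1)
    (hsum : ∀ᵐ t, ∑' l : (matrixLattice R + (F : Set (Fin d → ℝ)) : Set (Fin d → ℝ)),
      h (t - l) = 1) : (F.card : ℝ) = |R.det| := by
  have key := setLIntegral_tsum_periodic hR hF hm
  rw [hh, mul_one, lintegral_congr_ae (ae_restrict_of_ae hsum), setLIntegral_one,
    volume_fundamentalDomain_columnBasis] at key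
  have := congrArg ENNReal.toReal key
  rw [ENNReal.toReal_ofReal (abs_nonneg _), ENNReal.toReal_natCast] at this
  exact this.symm

theorem tsum_eq_one_of_card_eq_abs_det (hR : R.det ≠ 0) (hF : IsIncongruent R F)
    {h : (Fin d → ℝ) → ENNReal} (hm : Measurable h) (hh : ∫⁻ t, h t = 1)
    (hle : ∀ t, ∑' l : (matrixLattice R + (F : Set (Fin d → ℝ)) : Set (Fin d → ℝ)),
      h (t - l) ≤ 1)
    (hcard : (F.card : ℝ) = |R.det|) :
    ∀ᵐ t, ∑' l : (matrixLattice R + (F : Set (Fin d → ℝ)) : Set (Fin d → ℝ)), h (t - l) = 1 := by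
  have key := setLIntegral_tsum_periodic hR hF hm
  have hvol : ∫⁻ _ in ZSpan.fundamentalDomain (columnBasis R hR), (1 : ENNReal) = F.card := by
    rw [setLIntegral_one, volume_fundamentalDomain_columnBasis, ← hcard,
      ENNReal.ofReal_natCast]
  rw [hh, mul_one] at key
  have hD : ∀ᵐ t ∂volume.restrict (ZSpan.fundamentalDomain (columnBasis R hR)),
      ∑' l : (matrixLattice R + (F : Set (Fin d → ℝ)) : Set (Fin d → ℝ)), h (t - l) = 1 :=
    -- The sum is bounded by 1 and has the same finite integral as the constant 1 over the cell, so
    -- the two agree a.e. there.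
    ae_eq_of_ae_le_of_lintegral_le (Filter.Eventually.of_forall hle)
      (by rw [key]; exact ENNReal.natCast_ne_top _) aemeasurable_const (by rw [key, hvol])
  rw [ae_iff]
  refine (ZSpan.isAddFundamentalDomain (columnBasis R hR) volume).measure_zero_of_invariant _
    (fun g => ?_) ?_
  · ext t
    rw [Set.mem_vadd_set_iff_neg_vadd_mem]
    simp only [Set.mem_ofPred_eq]
    rw [tsum_periodic_vadd]
    exact hF
  · rwa [ae_restrict_iff' (ZSpan.fundamentalDomain_measurableSet _), ae_iff,
      show {a | ¬(a ∈ ZSpan.fundamentalDomain (columnBasis R hR) →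
        ∑' l : (matrixLattice R + (F : Set (Fin d → ℝ)) : Set (Fin d → ℝ)), h (a - l) = 1)}
        = {a | ¬ ∑' l : (matrixLattice R + (F : Set (Fin d → ℝ)) : Set (Fin d → ℝ)),
          h (a - l) = 1} ∩ ZSpan.fundamentalDomain (columnBasis R hR) by
          ext; simp [and_comm]] at hD

end Periodic

/-! ### Exponentials on the cube and its Fourier transform -/

theorem measurableSet_unitCube (d : ℕ) : MeasurableSet (unitCube d) :=
  MeasurableSet.univ_pi fun _ => measurableSet_Ico

theorem volume_unitCube (d : ℕ) : volume (unitCube d) = 1 := by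
  simp [unitCube, volume_pi_pi]

theorem mem_unitCube_iff {d : ℕ} {x : Fin d → ℝ} :
    x ∈ unitCube d ↔ ∀ j, 0 ≤ x j ∧ x j < 1 := by
  simp [unitCube]

instance (d : ℕ) : IsProbabilityMeasure (volume.restrict (unitCube d)) :=
  ⟨by rw [Measure.restrict_apply_univ, volume_unitCube]⟩

theorem expFun_eq_prod {d : ℕ} (l x : Fin d → ℝ) :
    expFun l x = ∏ j, Complex.exp (2 * (Real.pi : ℂ) * Complex.I * (l j : ℂ) * (x j : ℂ)) := by
  rw [expFun, ← Complex.exp_sum]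
  push_cast
  rw [Finset.mul_sum]
  simp only [mul_assoc]

theorem continuous_expFun {d : ℕ} : Continuous fun p : (Fin d → ℝ) × (Fin d → ℝ) =>
    expFun p.1 p.2 := by
  unfold expFun
  fun_prop

theorem norm_expFun {d : ℕ} (l x : Fin d → ℝ) : ‖expFun l x‖ = 1 := by
  rw [expFun, show 2 * (Real.pi : ℂ) * Complex.I * ((∑ j, l j * x j : ℝ) : ℂ)
    = ((2 * Real.pi * ∑ j, l j * x j : ℝ) : ℂ) * Complex.I by push_cast; ring]
  exact Complex.norm_exp_ofReal_mul_I _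

theorem conj_expFun_mul {d : ℕ} (l l' x : Fin d → ℝ) :
    (starRingEnd ℂ) (expFun l x) * expFun l' x = expFun (l' - l) x := by
  rw [expFun, expFun, expFun, ← Complex.exp_conj, ← Complex.exp_add]
  congr 1
  simp only [map_mul, map_ofNat, Complex.conj_ofReal, Complex.conj_I, Pi.sub_apply, sub_mul,
    Finset.sum_sub_distrib]
  push_cast
  ring

/-- The Fourier transform `v ↦ ∫_{I^d} e_v` of the unit cube. -/
noncomputable def cubeKernel {d : ℕ} (v : Fin d → ℝ) : ℂ := ∫ x in unitCube d, expFun v x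

theorem cubeKernel_eq_prod {d : ℕ} (v : Fin d → ℝ) :
    cubeKernel v = ∏ j, ∫ x in (0 : ℝ)..1,
      Complex.exp (2 * (Real.pi : ℂ) * Complex.I * (v j : ℂ) * (x : ℂ)) := by
  simp only [cubeKernel, expFun_eq_prod]
  rw [unitCube, volume_pi, Measure.restrict_pi_pi, integral_fintype_prod_eq_prod
    (fun j (y : ℝ) => Complex.exp (2 * (Real.pi : ℂ) * Complex.I * (v j : ℂ) * (y : ℂ)))]
  refine Finset.prod_congr rfl fun j _ => ?_
  rw [intervalIntegral.integral_of_le zero_le_one, restrict_Ico_eq_restrict_Ioc]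

theorem intervalIntegral_exp_eq_zero_iff (a : ℝ) :
    ∫ x in (0 : ℝ)..1, Complex.exp (2 * (Real.pi : ℂ) * Complex.I * (a : ℂ) * (x : ℂ)) = 0 ↔
      ∃ n : ℤ, n ≠ 0 ∧ a = n := by
  by_cases ha : a = 0
  · subst ha
    simp only [Complex.ofReal_zero, mul_zero, zero_mul, Complex.exp_zero,
      intervalIntegral.integral_const, sub_zero, one_smul, one_ne_zero, false_iff]
    rintro ⟨n, hn, h⟩
    exact hn (by exact_mod_cast h.symm)
  · have hc : 2 * (Real.pi : ℂ) * Complex.I * (a : ℂ) ≠ 0 :=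
      mul_ne_zero Complex.two_pi_I_ne_zero (by exact_mod_cast ha)
    rw [integral_exp_mul_complex hc, div_eq_zero_iff, or_iff_left hc, sub_eq_zero]
    simp only [Complex.ofReal_one, mul_one, Complex.ofReal_zero, mul_zero, Complex.exp_zero]
    rw [Complex.exp_eq_one_iff]
    refine exists_congr fun n => ?_
    rw [mul_comm (n : ℂ), mul_right_inj' Complex.two_pi_I_ne_zero]
    constructor
    · intro h
      have h' : a = n := by exact_mod_cast h
      refine ⟨?_, h'⟩
      rintro rfl
      exact ha (by simpa using h')
    · rintro ⟨-, h⟩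
      rw [h]
      push_cast
      rfl

/-- The kernel is a product of one-dimensional factors, each vanishing exactly at the nonzero
integers. Orthogonality on the cube is thus the same relation that Keller's theorem produces for
tilings. -/
theorem cubeKernel_sub_eq_zero_iff {d : ℕ} (x y : Fin d → ℝ) :
    cubeKernel (x - y) = 0 ↔ IsSeparated x y := by
  rw [cubeKernel_eq_prod, Finset.prod_eq_zero_iff]
  simp only [Finset.mem_univ, true_and, intervalIntegral_exp_eq_zero_iff, Pi.sub_apply]
  rfl

theorem cubeKernel_zero (d : ℕ) : cubeKernel (0 : Fin d → ℝ) = 1 := by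
  simp [cubeKernel_eq_prod]

theorem toComplexVec_mem_cubeZeroSet_iff {d : ℕ} (v : Fin d → ℝ) :
    toComplexVec v ∈ cubeZeroSet d ↔ cubeKernel v = 0 := by
  simp only [cubeZeroSet, Set.mem_ofPred_eq, cubeKernel, expFun, toComplexVec]
  push_cast
  rfl

theorem continuous_cubeKernel {d : ℕ} : Continuous (cubeKernel (d := d)) := by
  refine continuous_of_dominated (bound := fun _ => 1) (fun v => ?_) (fun v => ?_)
    (integrable_const _) ?_
  · exact (continuous_expFun.comp (by fun_prop : Continuous fun x => (v, x))).aestronglyMeasurable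
  · exact Filter.Eventually.of_forall fun x => (norm_expFun v x).le
  · exact Filter.Eventually.of_forall fun x =>
      continuous_expFun.comp (by fun_prop : Continuous fun v => (v, x))

theorem memLp_expFun {d : ℕ} (l : Fin d → ℝ) :
    MemLp (expFun l) 2 (volume.restrict (unitCube d)) :=
  MemLp.of_bound
    (continuous_expFun.comp (by fun_prop : Continuous fun x => (l, x))).aestronglyMeasurable 1
    (Filter.Eventually.of_forall fun x => (norm_expFun l x).le)

/-- The exponential `e_l` as an element of `L²(I^d)`. -/
noncomputable def cubeExp {d : ℕ} (l : Fin d → ℝ) : Lp ℂ 2 (volume.restrict (unitCube d)) :=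
  (memLp_expFun l).toLp (expFun l)

theorem coeFn_cubeExp {d : ℕ} (l : Fin d → ℝ) :
    cubeExp l =ᵐ[volume.restrict (unitCube d)] expFun l := MemLp.coeFn_toLp _

theorem inner_cubeExp {d : ℕ} (l l' : Fin d → ℝ) :
    inner ℂ (cubeExp l) (cubeExp l') = cubeKernel (l' - l) := by
  rw [L2.inner_def, cubeKernel]
  refine integral_congr_ae ?_
  filter_upwards [coeFn_cubeExp l, coeFn_cubeExp l'] with x hx hx'
  rw [hx, hx', RCLike.inner_apply', conj_expFun_mul]

theorem norm_cubeExp {d : ℕ} (l : Fin d → ℝ) : ‖cubeExp l‖ = 1 := by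
  have h : ‖cubeExp l‖ ^ 2 = 1 := by
    rw [norm_sq_eq_re_inner (𝕜 := ℂ), inner_cubeExp, sub_self, cubeKernel_zero, RCLike.one_re]
  exact (pow_eq_one_iff_of_nonneg (norm_nonneg _) two_ne_zero).1 h

/-- The squared distance between `cubeExp s` and `cubeExp t` is 2 - 2 Re `cubeKernel (t - s)`, so
continuity of the kernel suffices. -/
theorem continuous_cubeExp {d : ℕ} : Continuous (cubeExp (d := d)) := by
  rw [continuous_iff_continuousAt]
  intro t
  rw [ContinuousAt, tendsto_iff_norm_sub_tendsto_zero]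
  have key : ∀ s, ‖cubeExp s - cubeExp t‖ = Real.sqrt (2 - 2 * (cubeKernel (t - s)).re) := by
    intro s
    rw [← Real.sqrt_sq (norm_nonneg (cubeExp s - cubeExp t)), norm_sub_sq (𝕜 := ℂ),
      norm_cubeExp, norm_cubeExp, inner_cubeExp, RCLike.re_eq_complex_re]
    congr 1
    ring
  simp only [key]
  have hcont : Continuous fun s => Real.sqrt (2 - 2 * (cubeKernel (t - s)).re) := by
    have : Continuous fun s => cubeKernel (t - s) := continuous_cubeKernel.comp (by fun_prop)
    fun_prop
  simpa [cubeKernel_zero] using hcont.tendsto t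

/-! ### Totality of the integer frequencies -/

/-- The section of the covering map `ℝ^d → (ℝ/ℤ)^d` with values in the unit cube. -/
noncomputable def torusSection {d : ℕ} (y : UnitAddTorus (Fin d)) : Fin d → ℝ :=
  fun j => (AddCircle.measurableEquivIco 1 0 (y j) : ℝ)

theorem measurable_torusSection {d : ℕ} : Measurable (torusSection (d := d)) :=
  measurable_pi_lambda _ fun j => measurable_subtype_coe.comp
    ((AddCircle.measurableEquivIco 1 0).measurable.comp (measurable_pi_apply j))

theorem torusSection_coe {d : ℕ} {x : Fin d → ℝ} (hx : x ∈ unitCube d) :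
    torusSection (fun j => (x j : UnitAddCircle)) = x := by
  funext j
  have : x j ∈ Set.Ico (0 : ℝ) (0 + 1) := by
    have := mem_unitCube_iff.1 hx j
    simpa using this
  exact AddCircle.equivIco_coe_of_mem (p := (1 : ℝ)) (a := 0) this

theorem expFun_torusSection {d : ℕ} (k : Fin d → ℤ) (y : UnitAddTorus (Fin d)) :
    expFun (fun j => (k j : ℝ)) (torusSection y) = UnitAddTorus.mFourier k y := by
  rw [expFun_eq_prod]
  refine Finset.prod_congr rfl fun j _ => ?_
  have : y j = ((torusSection y j : ℝ) : UnitAddCircle) :=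
    (AddCircle.coe_equivIco (p := (1 : ℝ)) (a := 0) (y := y j)).symm
  rw [this, fourier_coe_apply]
  simp

/-- The exponentials with integer frequencies are total in `L²(I^d)`. -/
theorem eq_zero_of_forall_inner_cubeExp_int {d : ℕ}
    (f : Lp ℂ 2 (volume.restrict (unitCube d)))
    (hf : ∀ k : Fin d → ℤ, inner ℂ (cubeExp fun j => (k j : ℝ)) f = 0) : f = 0 := by
  have hq : Measurable fun (x : Fin d → ℝ) (j : Fin d) => (x j : UnitAddCircle) :=
    measurable_pi_lambda _ fun j => AddCircle.measurable_mk'.comp (measurable_pi_apply j)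
  -- Composition with `torusSection` is an isometry from L² of the cube into L²(ν) taking integer
  -- exponentials to characters. Since ν is a finite measure, uniform density of trigonometric
  -- polynomials gives density in L²(ν); ν need not be identified with Haar measure.
  set ν : Measure (UnitAddTorus (Fin d)) :=
    (volume.restrict (unitCube d)).map fun x j => (x j : UnitAddCircle) with hν
  have : IsProbabilityMeasure ν := Measure.isProbabilityMeasure_map hq.aemeasurable
  have hσ : MeasurePreserving torusSection ν (volume.restrict (unitCube d)) := by
    refine ⟨measurable_torusSection, ?_⟩
    rw [hν, Measure.map_map measurable_torusSection hq]
    conv_rhs => rw [← Measure.map_id (μ := volume.restrict (unitCube d))]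
    refine Measure.map_congr ?_
    filter_upwards [ae_restrict_mem (measurableSet_unitCube d)] with x hx
    exact torusSection_coe hx
  let V := Lp.compMeasurePreservingₗᵢ (p := 2) (E := ℂ) ℂ torusSection hσ
  have hV : ∀ k : Fin d → ℤ, V (cubeExp fun j => (k j : ℝ))
      = ContinuousMap.toLp 2 ν ℂ (UnitAddTorus.mFourier k) := by
    intro k
    refine Lp.ext ?_
    have h1 := Lp.coeFn_compMeasurePreserving (cubeExp fun j => (k j : ℝ)) hσ
    have h2 := hσ.quasiMeasurePreserving.ae_eq_comp (coeFn_cubeExp fun j => (k j : ℝ))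
    have h3 := ContinuousMap.coeFn_toLp (p := 2) (𝕜 := ℂ) ν (UnitAddTorus.mFourier k)
    refine h1.trans (h2.trans (Filter.EventuallyEq.trans ?_ h3.symm))
    exact Filter.Eventually.of_forall fun y => expFun_torusSection k y
  have hdense := (ContinuousMap.toLp_denseRange ℂ ν ℂ
    (ENNReal.ofNat_ne_top (n := 2))).topologicalClosure_map_submodule
      (UnitAddTorus.span_mFourier_closure_eq_top (d := Fin d))
  rw [Submodule.topologicalClosure_eq_top_iff, Submodule.map_span] at hdense
  have hmem : V f ∈ (⊥ : Submodule ℂ (Lp ℂ 2 ν)) := by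
    rw [← hdense, Submodule.mem_orthogonal]
    intro u hu
    induction hu using Submodule.span_induction with
    | mem u hu =>
      obtain ⟨_, ⟨k, rfl⟩, rfl⟩ := hu
      have := V.inner_map_map (cubeExp fun j => (k j : ℝ)) f
      rw [hf, hV] at this
      exact this
    | zero => simp
    | add u v _ _ hu hv => rw [inner_add_left, hu, hv, add_zero]
    | smul a u _ hu => rw [inner_smul_left, hu, mul_zero]
  rw [Submodule.mem_bot] at hmem
  exact V.injective (hmem.trans (map_zero V).symm)

/-! ### Equality in Bessel's inequality -/

section Hilbert

variable {E ι : Type*} [NormedAddCommGroup E] [InnerProductSpace ℂ E] {v : ι → E}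

theorem tsum_enorm_inner_sq (hv : Orthonormal ℂ v) (x : E) :
    ∑' i, ‖inner ℂ (v i) x‖ₑ ^ 2 = ENNReal.ofReal (∑' i, ‖inner ℂ (v i) x‖ ^ 2) := by
  rw [ENNReal.ofReal_tsum_of_nonneg (fun _ => sq_nonneg _) (hv.inner_products_summable x)]
  refine tsum_congr fun i => ?_
  rw [ENNReal.ofReal_pow (norm_nonneg _), ofReal_norm]

/-- Split `x = y + z` along the closed span and its complement. The coefficients see only `y`, so
Bessel gives ‖x‖ ≤ ‖y‖, and Pythagoras forces `z = 0`. -/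
theorem mem_closure_span_of_tsum_eq [CompleteSpace E] (hv : Orthonormal ℂ v) {x : E}
    (hx : ∑' i, ‖inner ℂ (v i) x‖ ^ 2 = ‖x‖ ^ 2) :
    x ∈ (Submodule.span ℂ (Set.range v)).topologicalClosure := by
  set U := (Submodule.span ℂ (Set.range v)).topologicalClosure with hU
  have : CompleteSpace U :=
    (Submodule.isClosed_topologicalClosure _).completeSpace_coe
  obtain ⟨y, hy, z, hz, rfl⟩ := U.exists_add_mem_mem_orthogonal x
  have hvU : ∀ i, v i ∈ U := fun i =>
    Submodule.le_topologicalClosure _ (Submodule.subset_span ⟨i, rfl⟩)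
  have e : ∀ i, inner ℂ (v i) (y + z) = inner ℂ (v i) y := fun i => by
    rw [inner_add_right, hz _ (hvU i), add_zero]
  have hle := hv.tsum_inner_products_le y
  simp only [e] at hx
  have hpyth := norm_add_sq_eq_norm_sq_add_norm_sq_of_inner_eq_zero y z (hz y hy)
  have hz0 : ‖z‖ * ‖z‖ = 0 := by nlinarith [mul_self_nonneg ‖z‖]
  have : z = 0 := by simpa using hz0
  rwa [this, add_zero]

theorem tsum_eq_of_closure_span_eq_top [CompleteSpace E] (hv : Orthonormal ℂ v)
    (htop : (Submodule.span ℂ (Set.range v)).topologicalClosure = ⊤) (x : E) :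
    ∑' i, ‖inner ℂ (v i) x‖ ^ 2 = ‖x‖ ^ 2 := by
  have h := (HilbertBasis.mk hv htop.ge).hasSum_inner_mul_inner x x
  rw [HilbertBasis.coe_mk] at h
  have h' := (RCLike.hasSum_re ℂ h).tsum_eq
  rw [← norm_sq_eq_re_inner] at h'
  rw [← h']
  refine tsum_congr fun i => ?_
  rw [← inner_conj_symm x, RCLike.conj_mul]
  norm_cast

end Hilbert

/-! ### Spectra and the periodized power spectrum -/

/-- The power spectrum of the unit cube. -/
noncomputable def cubePower {d : ℕ} (v : Fin d → ℝ) : ENNReal := ‖cubeKernel v‖ₑ ^ 2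

theorem measurable_cubePower {d : ℕ} : Measurable (cubePower (d := d)) :=
  continuous_cubeKernel.enorm.measurable.pow_const 2

theorem orthonormal_cubeExp {d : ℕ} {T : Set (Fin d → ℝ)}
    (hT : T.Pairwise IsSeparated) : Orthonormal ℂ fun l : T => cubeExp (l : Fin d → ℝ) := by
  refine ⟨fun l => norm_cubeExp _, fun l l' hne => ?_⟩
  dsimp only
  rw [inner_cubeExp, cubeKernel_sub_eq_zero_iff]
  exact hT l'.2 l.2 fun h => hne (Subtype.ext h.symm)

/-- The terms are the squared Fourier coefficients of `cubeExp t`, a unit vector, so Bessel and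
Parseval become statements about a periodized function. -/
theorem tsum_cubePower_eq {d : ℕ} {T : Set (Fin d → ℝ)} (hT : T.Pairwise IsSeparated)
    (t : Fin d → ℝ) : ∑' l : T, cubePower (t - (l : Fin d → ℝ))
      = ENNReal.ofReal (∑' l : T, ‖inner ℂ (cubeExp (l : Fin d → ℝ)) (cubeExp t)‖ ^ 2) := by
  rw [← tsum_enorm_inner_sq (orthonormal_cubeExp hT)]
  simp only [inner_cubeExp, cubePower]

theorem tsum_cubePower_le_one {d : ℕ} {T : Set (Fin d → ℝ)} (hT : T.Pairwise IsSeparated)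
    (t : Fin d → ℝ) : ∑' l : T, cubePower (t - (l : Fin d → ℝ)) ≤ 1 := by
  rw [tsum_cubePower_eq hT, ENNReal.ofReal_le_one]
  have := (orthonormal_cubeExp hT).tsum_inner_products_le (cubeExp t)
  rwa [norm_cubeExp, one_pow] at this

theorem tsum_cubePower_eq_one {d : ℕ} {T : Set (Fin d → ℝ)} (hT : T.Pairwise IsSeparated)
    (htop : (Submodule.span ℂ
      (Set.range fun l : T => cubeExp (l : Fin d → ℝ))).topologicalClosure = ⊤)
    (t : Fin d → ℝ) : ∑' l : T, cubePower (t - (l : Fin d → ℝ)) = 1 := by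
  rw [tsum_cubePower_eq hT, tsum_eq_of_closure_span_eq_top (orthonormal_cubeExp hT) htop,
    norm_cubeExp, one_pow, ENNReal.ofReal_one]

theorem closure_span_eq_top_of_int_mem {d : ℕ}
    {U : Submodule ℂ (Lp ℂ 2 (volume.restrict (unitCube d)))}
    (h : ∀ k : Fin d → ℤ, (cubeExp fun j => (k j : ℝ)) ∈ U) : U.topologicalClosure = ⊤ := by
  rw [Submodule.topologicalClosure_eq_top_iff, Submodule.eq_bot_iff]
  exact fun f hf => eq_zero_of_forall_inner_cubeExp_int f fun k => hf _ (h k)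

/-- Equality in Bessel puts `cubeExp t` in the closed span for a.e. `t`, hence for a dense set of
`t`. By continuity this extends to all `t`, in particular to the integer frequencies. -/
theorem closure_span_eq_top_of_tsum_cubePower {d : ℕ} {T : Set (Fin d → ℝ)}
    (hT : T.Pairwise IsSeparated) (h : ∀ᵐ t : Fin d → ℝ, ∑' l : T, cubePower (t - (l : Fin d → ℝ)) = 1) :
    (Submodule.span ℂ
      (Set.range fun l : T => cubeExp (l : Fin d → ℝ))).topologicalClosure = ⊤ := by
  set U := Submodule.span ℂ (Set.range fun l : T => cubeExp (l : Fin d → ℝ))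
  have hclosed : IsClosed {t : Fin d → ℝ | cubeExp t ∈ U.topologicalClosure} :=
    U.isClosed_topologicalClosure.preimage continuous_cubeExp
  have hdense : Dense {t : Fin d → ℝ | cubeExp t ∈ U.topologicalClosure} := by
    refine Measure.dense_of_ae (μ := volume) ?_
    filter_upwards [h] with t ht
    refine mem_closure_span_of_tsum_eq (orthonormal_cubeExp hT) ?_
    rw [tsum_cubePower_eq hT, ENNReal.ofReal_eq_one] at ht
    rw [ht, norm_cubeExp, one_pow]
  have hall : ∀ t : Fin d → ℝ, cubeExp t ∈ U.topologicalClosure := fun t => by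
    have := hclosed.closure_eq ▸ hdense t
    exact this
  have := closure_span_eq_top_of_int_mem fun k => hall fun j => (k j : ℝ)
  rwa [IsClosed.submodule_topologicalClosure_eq U.isClosed_topologicalClosure] at this

/-- The averaging formula is applied to the lattice ℤ^d, already known to be a spectrum: the
periodized sum is 1 and the cell has volume 1. -/
theorem lintegral_cubePower (d : ℕ) : ∫⁻ t : Fin d → ℝ, cubePower t = 1 := by
  have hR : (1 : Matrix (Fin d) (Fin d) ℝ).det ≠ 0 := by simp
  have hF : IsIncongruent (1 : Matrix (Fin d) (Fin d) ℝ) {0} := by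
    intro f hf f' hf' _
    rw [Finset.mem_singleton] at hf hf'
    rw [hf, hf']
  have hmem : ∀ v : Fin d → ℝ, v ∈ matrixLattice (1 : Matrix (Fin d) (Fin d) ℝ)
      + (({0} : Finset (Fin d → ℝ)) : Set (Fin d → ℝ)) ↔
        ∃ k : Fin d → ℤ, (fun j => (k j : ℝ)) = v := by
    intro v
    simp [matrixLattice]
  have hT : (matrixLattice (1 : Matrix (Fin d) (Fin d) ℝ)
      + (({0} : Finset (Fin d → ℝ)) : Set (Fin d → ℝ))).Pairwise IsSeparated := by
    intro l hl l' hl' hne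
    obtain ⟨k, rfl⟩ := (hmem l).1 hl
    obtain ⟨k', rfl⟩ := (hmem l').1 hl'
    obtain ⟨j, hj⟩ := Function.ne_iff.1 hne
    exact ⟨j, k j - k' j, sub_ne_zero.2 fun h => hj (by rw [h]), by push_cast; rfl⟩
  have htop := closure_span_eq_top_of_int_mem (U := Submodule.span ℂ (Set.range
    fun l : (matrixLattice (1 : Matrix (Fin d) (Fin d) ℝ)
      + (({0} : Finset (Fin d → ℝ)) : Set (Fin d → ℝ)) : Set (Fin d → ℝ)) =>
        cubeExp (l : Fin d → ℝ)))
    fun k => Submodule.subset_span ⟨⟨_, (hmem _).2 ⟨k, rfl⟩⟩, rfl⟩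
  have key := setLIntegral_tsum_periodic hR hF measurable_cubePower
  simp only [tsum_cubePower_eq_one hT htop] at key
  rw [setLIntegral_one, volume_fundamentalDomain_columnBasis] at key
  simpa using key.symm

theorem isSpectralPair_unitCube_iff {d : ℕ} {T : Set (Fin d → ℝ)} :
    IsSpectralPair (unitCube d) T ↔ T.Pairwise IsSeparated ∧
      (Submodule.span ℂ
        (Set.range fun l : T => cubeExp (l : Fin d → ℝ))).topologicalClosure = ⊤ := by
  have horth : (∀ l ∈ T, ∀ l' ∈ T, l ≠ l' →
      ∫ x in unitCube d, (starRingEnd ℂ) (expFun l x) * expFun l' x = 0) ↔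
        T.Pairwise IsSeparated := by
    simp only [conj_expFun_mul]
    constructor
    · intro h l hl l' hl' hne
      exact (cubeKernel_sub_eq_zero_iff l l').1 (h l' hl' l hl hne.symm)
    · intro h l hl l' hl' hne
      exact (cubeKernel_sub_eq_zero_iff l' l).2 (h hl' hl hne.symm)
  have hset : {g : Lp ℂ 2 (volume.restrict (unitCube d)) |
      ∃ l ∈ T, g =ᵐ[volume.restrict (unitCube d)] expFun l}
        = Set.range fun l : T => cubeExp (l : Fin d → ℝ) := by
    ext g
    constructor
    · rintro ⟨l, hl, hg⟩
      exact ⟨⟨l, hl⟩, Lp.ext ((coeFn_cubeExp l).trans hg.symm)⟩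
    · rintro ⟨l, rfl⟩
      exact ⟨l, l.2, coeFn_cubeExp _⟩
  constructor
  · intro h
    exact ⟨horth.1 h.orthogonal, hset ▸ h.total⟩
  · rintro ⟨h1, h2⟩
    refine ⟨measurableSet_unitCube d, ?_, ?_, horth.2 h1, by rw [hset]; exact h2⟩ <;>
      simp [volume_unitCube]

theorem isSpectralPair_periodic_iff {d : ℕ} {R : Matrix (Fin d) (Fin d) ℝ} (hR : R.det ≠ 0)
    {F : Finset (Fin d → ℝ)} (hF : IsIncongruent R F) :
    IsSpectralPair (unitCube d) (matrixLattice R + (F : Set (Fin d → ℝ))) ↔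
      (F.card : ℝ) = |R.det| ∧
        (matrixLattice R + (F : Set (Fin d → ℝ))).Pairwise IsSeparated := by
  rw [isSpectralPair_unitCube_iff]
  constructor
  · rintro ⟨hT, htop⟩
    exact ⟨card_eq_abs_det_of_tsum_eq_one hR hF measurable_cubePower (lintegral_cubePower d)
      (Filter.Eventually.of_forall (tsum_cubePower_eq_one hT htop)), hT⟩
  · rintro ⟨hcard, hT⟩
    exact ⟨hT, closure_span_eq_top_of_tsum_cubePower hT
      (tsum_eq_one_of_card_eq_abs_det hR hF measurable_cubePower (lintegral_cubePower d)
        (tsum_cubePower_le_one hT) hcard)⟩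

/-! ### Tilings and the periodized indicator -/

theorem sub_mem_unitCube_iff {d : ℕ} {x l : Fin d → ℝ} :
    x - l ∈ unitCube d ↔ ∀ j, l j ≤ x j ∧ x j < l j + 1 := by
  rw [mem_unitCube_iff]
  refine forall_congr' fun j => ?_
  simp only [Pi.sub_apply, sub_nonneg, sub_lt_iff_lt_add']

theorem mem_image_add_unitCube_iff {d : ℕ} {x l : Fin d → ℝ} :
    x ∈ (fun y => y + l) '' unitCube d ↔ x - l ∈ unitCube d := by
  simp [Set.image_add_right, sub_eq_add_neg]

theorem tsum_indicator_unitCube {d : ℕ} (T : Set (Fin d → ℝ)) (x : Fin d → ℝ) :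
    ∑' l : T, (unitCube d).indicator (1 : (Fin d → ℝ) → ENNReal) (x - l)
      = {l : T | x - l ∈ unitCube d}.encard := by
  rw [← ENNReal.tsum_set_one, tsum_subtype {l : T | x - l ∈ unitCube d} fun _ => (1 : ENNReal)]
  rfl

theorem tsum_indicator_unitCube_eq_one_iff {d : ℕ} {T : Set (Fin d → ℝ)} {x : Fin d → ℝ} :
    ∑' l : T, (unitCube d).indicator (1 : (Fin d → ℝ) → ENNReal) (x - l) = 1 ↔
      ∃! l : T, x - l ∈ unitCube d := by
  rw [tsum_indicator_unitCube, ← ENat.toENNReal_one, ENat.toENNReal_inj, Set.encard_eq_one]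
  simp only [Set.eq_singleton_iff_unique_mem, ExistsUnique, Set.mem_ofPred_eq]

/-- The corners of two cubes sharing a point differ by less than 1 in every coordinate, which
excludes a nonzero integer difference. -/
theorem tsum_indicator_unitCube_le_one {d : ℕ} {T : Set (Fin d → ℝ)}
    (hT : T.Pairwise IsSeparated) (x : Fin d → ℝ) :
    ∑' l : T, (unitCube d).indicator (1 : (Fin d → ℝ) → ENNReal) (x - l) ≤ 1 := by
  rw [tsum_indicator_unitCube, ← ENat.toENNReal_one, ENat.toENNReal_le, Set.encard_le_one_iff]
  intro l l' hl hl'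
  by_contra hne
  obtain ⟨j, n, hn, hj⟩ := hT l.2 l'.2 fun h => hne (Subtype.ext h)
  have h1 := sub_mem_unitCube_iff.1 hl j
  have h2 := sub_mem_unitCube_iff.1 hl' j
  have h3 : (n : ℝ) < 1 := by linarith
  have h4 : (-1 : ℝ) < n := by linarith
  have h5 : n < 1 := by exact_mod_cast h3
  have h6 : -1 < n := by exact_mod_cast h4
  omega

theorem isTilingPair_unitCube_iff {d : ℕ} {T : Set (Fin d → ℝ)} (hT : Countable T) :
    IsTilingPair (unitCube d) T ↔ ∀ᵐ x : Fin d → ℝ, ∃! l : T, x - l ∈ unitCube d := by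
  constructor
  · intro h
    have h1 : ∀ᵐ x : Fin d → ℝ, x ∈ ⋃ l ∈ T, (fun x => x + l) '' unitCube d := h.cover
    have h2 : ∀ᵐ x : Fin d → ℝ, ∀ l l' : T, l ≠ l' →
        x ∉ ((fun x => x + (l : Fin d → ℝ)) '' unitCube d) ∩
          ((fun x => x + (l' : Fin d → ℝ)) '' unitCube d) := by
      -- Countability of `T` allows the null overlaps of all pairs to be discarded together.
      refine ae_all_iff.2 fun l => ae_all_iff.2 fun l' => ?_
      by_cases hne : l = l'
      · simp [hne]
      · have := h.disjoint l l.2 l' l'.2 fun h => hne (Subtype.ext h)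
        filter_upwards [measure_eq_zero_iff_ae_notMem.1 this] with x hx _ using hx
    filter_upwards [h1, h2] with x hx1 hx2
    simp only [Set.mem_iUnion, mem_image_add_unitCube_iff] at hx1
    obtain ⟨l, hl, hx⟩ := hx1
    refine ⟨⟨l, hl⟩, hx, fun l' hl' => ?_⟩
    by_contra hne
    exact hx2 _ _ hne ⟨mem_image_add_unitCube_iff.2 hl', mem_image_add_unitCube_iff.2 hx⟩
  · intro h
    refine ⟨measurableSet_unitCube d, by simp [volume_unitCube], ?_, ?_⟩
    · change ∀ᵐ x : Fin d → ℝ, x ∈ ⋃ l ∈ T, (fun x => x + l) '' unitCube d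
      filter_upwards [h] with x hx
      obtain ⟨l, hl, -⟩ := hx
      simp only [Set.mem_iUnion, mem_image_add_unitCube_iff]
      exact ⟨l, l.2, hl⟩
    · intro l hl l' hl' hne
      rw [measure_eq_zero_iff_ae_notMem]
      filter_upwards [h] with x hx hmem
      have := hx.unique (y₁ := ⟨l, hl⟩) (y₂ := ⟨l', hl'⟩)
        (mem_image_add_unitCube_iff.1 hmem.1) (mem_image_add_unitCube_iff.1 hmem.2)
      exact hne (congrArg Subtype.val this)

/-- Membership in a half-open cube is right-continuous. -/
theorem eventually_sub_mem_unitCube_iff {d : ℕ} (x l : Fin d → ℝ) :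
    ∀ᶠ y in nhdsWithin x (Set.Ici x), (y - l ∈ unitCube d ↔ x - l ∈ unitCube d) := by
  have hj : ∀ j, ∀ᶠ y in nhdsWithin x (Set.Ici x),
      ((l j ≤ y j ∧ y j < l j + 1) ↔ (l j ≤ x j ∧ x j < l j + 1)) := by
    intro j
    have hcont : ∀ b : ℝ, x j < b → ∀ᶠ y in nhdsWithin x (Set.Ici x), y j < b :=
      fun b hb => (((continuous_apply j).tendsto x).eventually (gt_mem_nhds hb)).filter_mono
        nhdsWithin_le_nhds
    have hle : ∀ᶠ y in nhdsWithin x (Set.Ici x), x j ≤ y j := by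
      filter_upwards [self_mem_nhdsWithin] with y hy using hy j
    rcases lt_or_ge (x j) (l j) with h | h
    · filter_upwards [hcont _ h] with y hy
      constructor <;> rintro ⟨h1, h2⟩ <;> linarith
    · rcases lt_or_ge (x j) (l j + 1) with h' | h'
      · filter_upwards [hcont _ h', hle] with y hy1 hy2
        exact ⟨fun _ => ⟨h, h'⟩, fun _ => ⟨h.trans hy2, hy1⟩⟩
      · filter_upwards [hle] with y hy
        constructor <;> rintro ⟨h1, h2⟩ <;> linarith
  filter_upwards [Filter.eventually_all.2 hj] with y hy
  rw [sub_mem_unitCube_iff, sub_mem_unitCube_iff]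
  exact forall_congr' hy

/-- A one-sided neighbourhood of `x` contains a nonempty open set of points larger in every
coordinate, and a set of full measure is dense. -/
theorem exists_mem_of_eventually_of_ae {d : ℕ} {x : Fin d → ℝ} {p q : (Fin d → ℝ) → Prop}
    (hp : ∀ᶠ y in nhdsWithin x (Set.Ici x), p y) (hq : ∀ᵐ y, q y) : ∃ y, p y ∧ q y := by
  obtain ⟨O, hO, hxO, hsub⟩ := mem_nhdsWithin.1 hp
  have hpos : IsOpen {y : Fin d → ℝ | ∀ j, x j < y j} := by
    simp only [Set.ofPred_forall]
    exact isOpen_iInter_of_finite fun j => isOpen_lt continuous_const (continuous_apply j)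
  have htend : Filter.Tendsto (fun ε : ℝ => x + fun _ => ε) (nhdsWithin 0 (Set.Ioi 0))
      (nhds x) := by
    have : Continuous fun ε : ℝ => x + fun _ : Fin d => ε := by fun_prop
    have h0 := this.tendsto 0
    rw [show (x + fun _ : Fin d => (0 : ℝ)) = x from add_zero x] at h0
    exact h0.mono_left nhdsWithin_le_nhds
  obtain ⟨ε, hεO, hε⟩ := ((htend.eventually (hO.mem_nhds hxO)).and self_mem_nhdsWithin).exists
  obtain ⟨y, ⟨hyO, hyx⟩, hyq⟩ := (Measure.dense_of_ae hq).inter_open_nonempty _ (hO.inter hpos)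
    ⟨_, hεO, fun j => lt_add_of_pos_right _ hε⟩
  exact ⟨y, hsub ⟨hyO, fun j => (hyx j).le⟩, hyq⟩

/-- An almost everywhere tiling by half-open cubes with locally finite positions is a partition. -/
theorem isCubePartition_of_ae {d : ℕ} {T : Set (Fin d → ℝ)}
    (hfin : ∀ x, (Metric.closedBall x 2 ∩ T).Finite)
    (hT : ∀ᵐ x : Fin d → ℝ, ∃! l : T, x - l ∈ unitCube d) :
    IsCubePartition fun l : T => (l : Fin d → ℝ) := by
  intro x
  simp only [← sub_mem_unitCube_iff]
  -- A cube containing `x`, or a point within 1 of `x`, has its corner within sup-distance 2 of `x`.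
  -- Only finitely many corners matter, so one `y` in the good set can agree with `x` on all of
  -- them.
  have near : ∀ᶠ y in nhdsWithin x (Set.Ici x), dist y x < 1 :=
    nhdsWithin_le_nhds (Metric.ball_mem_nhds x one_pos)
  have agree : ∀ᶠ y in nhdsWithin x (Set.Ici x), ∀ l ∈ Metric.closedBall x 2 ∩ T,
      (y - l ∈ unitCube d ↔ x - l ∈ unitCube d) :=
    (Filter.eventually_all_finite (hfin x)).2 fun l _ => eventually_sub_mem_unitCube_iff x l
  have dist_le : ∀ y l : Fin d → ℝ, y - l ∈ unitCube d → dist l y ≤ 1 := by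
    intro y l h
    rw [dist_pi_le_iff zero_le_one]
    intro j
    have := sub_mem_unitCube_iff.1 h j
    rw [Real.dist_eq, abs_le]
    constructor <;> linarith
  obtain ⟨y, ⟨hy, hyx⟩, l, hl, hlu⟩ := exists_mem_of_eventually_of_ae (agree.and near) hT
  refine ⟨l, (hy l ⟨?_, l.2⟩).1 hl, fun l' hl' => hlu l' ((hy l' ⟨?_, l'.2⟩).2 hl')⟩
  · have := dist_triangle l.1 y x
    have := dist_le y l hl
    rw [Metric.mem_closedBall]
    linarith
  · have := dist_le x l' hl'
    rw [Metric.mem_closedBall]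
    linarith

theorem finite_closedBall_inter_periodic {d : ℕ} {R : Matrix (Fin d) (Fin d) ℝ}
    (hR : R.det ≠ 0) (F : Finset (Fin d → ℝ)) (x : Fin d → ℝ) (r : ℝ) :
    (Metric.closedBall x r ∩ (matrixLattice R + (F : Set (Fin d → ℝ)))).Finite := by
  have hsub : Metric.closedBall x r ∩ (matrixLattice R + (F : Set (Fin d → ℝ))) ⊆
      ⋃ f ∈ F, (fun g => g + f) '' (Metric.closedBall (x - f) r ∩ latticeModule R hR) := by
    rintro _ ⟨hx, g, hg, f, hf, rfl⟩
    simp only [Set.mem_iUnion]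
    refine ⟨f, hf, g, ⟨?_, (mem_latticeModule hR).2 hg⟩, rfl⟩
    rw [Metric.mem_closedBall, dist_eq_norm] at hx ⊢
    convert hx using 2
    dsimp only
    abel
  refine Set.Finite.subset ?_ hsub
  exact F.finite_toSet.biUnion fun f _ =>
    (ZSpan.setFinite_inter (columnBasis R hR) Metric.isBounded_closedBall).image _

theorem isTilingPair_periodic_iff {d : ℕ} {R : Matrix (Fin d) (Fin d) ℝ} (hR : R.det ≠ 0)
    {F : Finset (Fin d → ℝ)} (hF : IsIncongruent R F) :
    IsTilingPair (unitCube d) (matrixLattice R + (F : Set (Fin d → ℝ))) ↔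
      (F.card : ℝ) = |R.det| ∧
        (matrixLattice R + (F : Set (Fin d → ℝ))).Pairwise IsSeparated := by
  have hm : Measurable ((unitCube d).indicator (1 : (Fin d → ℝ) → ENNReal)) :=
    measurable_one.indicator (measurableSet_unitCube d)
  have hint : ∫⁻ x, (unitCube d).indicator (1 : (Fin d → ℝ) → ENNReal) x = 1 := by
    rw [lintegral_indicator_one (measurableSet_unitCube d), volume_unitCube]
  rw [isTilingPair_unitCube_iff (countable_periodic hR hF)]
  constructor
  · intro h
    refine ⟨card_eq_abs_det_of_tsum_eq_one hR hF hm hint ?_, fun l hl l' hl' hne => ?_⟩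
    · filter_upwards [h] with x hx using tsum_indicator_unitCube_eq_one_iff.2 hx
    · exact (isCubePartition_of_ae (fun x => finite_closedBall_inter_periodic hR F x 2)
        h).isSeparated (τ := ⟨l, hl⟩) (σ := ⟨l', hl'⟩) fun h => hne (congrArg Subtype.val h)
  · rintro ⟨hcard, hT⟩
    filter_upwards [tsum_eq_one_of_card_eq_abs_det hR hF hm hint
      (tsum_indicator_unitCube_le_one hT) hcard] with x hx
    exact tsum_indicator_unitCube_eq_one_iff.1 hx

/-! ### The zero set condition and the choice of representatives -/

theorem image_toComplexVec_subset_iff {d : ℕ} {R : Matrix (Fin d) (Fin d) ℝ} (hR : R.det ≠ 0)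
    (F : Finset (Fin d → ℝ)) :
    toComplexVec '' (matrixLattice R + ((F : Set (Fin d → ℝ)) - (F : Set (Fin d → ℝ))))
        ⊆ cubeZeroSet d ∪ {0} ↔
      (matrixLattice R + (F : Set (Fin d → ℝ))).Pairwise IsSeparated := by
  have hz : ∀ v : Fin d → ℝ, toComplexVec v = 0 ↔ v = 0 := fun v => by
    simp [funext_iff, toComplexVec]
  simp only [← coe_latticeModule R hR]
  constructor
  · rintro h _ ⟨g, hg, f, hf, rfl⟩ _ ⟨g', hg', f', hf', rfl⟩ hne
    rw [← cubeKernel_sub_eq_zero_iff]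
    have := h ⟨(g - g') + (f - f'), Set.add_mem_add (sub_mem hg hg') (Set.sub_mem_sub hf hf'), rfl⟩
    rw [← add_sub_add_comm] at this
    rcases this with h0 | h0
    · exact (toComplexVec_mem_cubeZeroSet_iff _).1 h0
    · exact absurd (sub_eq_zero.1 ((hz _).1 h0)) hne
  · rintro h _ ⟨_, ⟨g, hg, _, ⟨f, hf, f', hf', rfl⟩, rfl⟩, rfl⟩
    -- The lattice part is absorbed into the first point, which exhibits the vector as a difference
    -- of two points of the periodic set.
    have e : g + (f - f') = (g + f) - (0 + f') := by abel
    dsimp only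
    rw [e]
    by_cases hne : g + f = 0 + f'
    · exact Or.inr ((hz _).2 (sub_eq_zero.2 hne))
    · exact Or.inl ((toComplexVec_mem_cubeZeroSet_iff _).2 ((cubeKernel_sub_eq_zero_iff _ _).2
        (h (Set.add_mem_add hg hf) (Set.add_mem_add (zero_mem (latticeModule R hR)) hf') hne)))

/-- An arbitrary periodic set may be given by a redundant `F`; keeping one representative of each
class modulo the lattice restores incongruence without changing the set. -/
theorem exists_isIncongruent {d : ℕ} {R : Matrix (Fin d) (Fin d) ℝ} (hR : R.det ≠ 0)
    (F : Finset (Fin d → ℝ)) : ∃ F' : Finset (Fin d → ℝ), IsIncongruent R F' ∧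
      matrixLattice R + (F' : Set (Fin d → ℝ)) = matrixLattice R + (F : Set (Fin d → ℝ)) := by
  obtain ⟨u, huF, hu⟩ := (F : Set (Fin d → ℝ)).exists_subset_bijOn (latticeModule R hR).mkQ
  lift u to Finset (Fin d → ℝ) using F.finite_toSet.subset huF
  refine ⟨u, fun f hf f' hf' h => hu.injOn hf hf' ?_, ?_⟩
  · exact (Submodule.Quotient.eq _).2 ((mem_latticeModule hR).2 h)
  · refine Set.Subset.antisymm (Set.add_subset_add_left huF) ?_
    rintro _ ⟨g, hg, f, hf, rfl⟩
    obtain ⟨f', hf', he⟩ := hu.surjOn ⟨f, hf, rfl⟩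
    have hmem : f - f' ∈ latticeModule R hR := (Submodule.Quotient.eq _).1 he.symm
    refine ⟨g + (f - f'), ?_, f', hf', by dsimp only; abel⟩
    rw [← coe_latticeModule R hR] at hg ⊢
    exact add_mem hg hmem

end CubeSpectra

theorem mainTheorem3 (d : ℕ) :
    (∀ (R : Matrix (Fin d) (Fin d) ℝ) (F : Finset (Fin d → ℝ)),
      R.det ≠ 0 →
      CubeSpectra.matrixLattice R ∩ ((F : Set (Fin d → ℝ)) - (F : Set (Fin d → ℝ))) = {0} →
      List.TFAE [
        CubeSpectra.IsSpectralPair (CubeSpectra.unitCube d)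
          (CubeSpectra.matrixLattice R + (F : Set (Fin d → ℝ))),
        CubeSpectra.IsTilingPair (CubeSpectra.unitCube d)
          (CubeSpectra.matrixLattice R + (F : Set (Fin d → ℝ))),
        (F.card : ℝ) = |R.det| ∧
          CubeSpectra.toComplexVec ''
              (CubeSpectra.matrixLattice R + ((F : Set (Fin d → ℝ)) - (F : Set (Fin d → ℝ))))
            ⊆ CubeSpectra.cubeZeroSet d ∪ {0}]) ∧
    (∀ T : Set (Fin d → ℝ), CubeSpectra.IsPeriodicSet T →
      (CubeSpectra.IsSpectralPair (CubeSpectra.unitCube d) T ↔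
        CubeSpectra.IsTilingPair (CubeSpectra.unitCube d) T)) := by
  constructor
  · intro R F hR hRF
    have hF : CubeSpectra.IsIncongruent R F := fun f hf f' hf' h =>
      sub_eq_zero.1 (Set.mem_singleton_iff.1 (hRF ▸ ⟨h, Set.sub_mem_sub hf hf'⟩))
    rw [CubeSpectra.isSpectralPair_periodic_iff hR hF, CubeSpectra.isTilingPair_periodic_iff hR hF,
      CubeSpectra.image_toComplexVec_subset_iff hR]
    -- After the rewriting, all three entries are literally the same proposition.
    tfae_have 1 ↔ 2 := Iff.rfl
    tfae_have 2 ↔ 3 := Iff.rfl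
    tfae_finish
  · rintro T ⟨R, F, hR, rfl⟩
    obtain ⟨F', hF', hT⟩ := CubeSpectra.exists_isIncongruent hR F
    rw [← hT, CubeSpectra.isSpectralPair_periodic_iff hR hF',
      CubeSpectra.isTilingPair_periodic_iff hR hF']
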